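/- A graph here is a finite multigraph without loops: parallel edges are allowed, and every edge joins two distinct vertices. Let $G$ be such a graph, $s \neq t$ two vertices of $G$ (the terminals), and $p \in [0,1]$. If each edge of $G$ is operational independently with probability $p$, the split reliability $\mathrm{SplitRel}_{s,t}(G,p)$ is the probability that every vertex of $G$ is joined by a path of operational edges to exactly one of $s$ and $t$; that is, $$\mathrm{SplitRel}_{s,t}(G,p)=\sum_{F} p^{|F|}(1-p)^{|E(G)\setminus F|},$$ where the sum is over all $F \subseteq E(G)$ such that the spanning subgraph $(V(G),F)$ has exactly two connected components, one containing $s$ and the other containing $t$. A connected graph $G$ with $n$ vertices and $m$ edges, together with distinct terminals $s,t$, is called an optimal $(n,m)$-graph if for every connected graph $H$ with $n$ vertices and $m$ edges, all distinct vertices $s',t'$ of $H$, and all $p \in (0,1)$, $$\mathrm{SplitRel}_{s,t}(G,p) \ge \mathrm{SplitRel}_{s',t'}(H,p)$$ (by continuity in $p$, it is equivalent to require this for all $p \in [0,1]$). **Theorem.** Let $n \ge 2$ and $m \ge n-1$ be integers. An optimal $(n,m)$-graph exists if and only if $n \le 3$, or $m = n-1$, or $n = m = 4$. -/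

import Mathlib

open scoped Graph

namespace Graph

/-- `x` and `y` can communicate in `G`: they are joined by a (possibly trivial) walk. -/
def Communicates {α β : Type*} (G : Graph α β) (x y : α) : Prop :=
  Relation.ReflTransGen G.Adj x y

/-- A multigraph is connected if it has a vertex and any two of its vertices communicate. -/
def IsConnected {α β : Type*} (G : Graph α β) : Prop :=
  V(G).Nonempty ∧ ∀ x ∈ V(G), ∀ y ∈ V(G), G.Communicates x y

/-- Every vertex of `G` communicates with exactly one of `s` and `t`. -/
def IsSplit {α β : Type*} (G : Graph α β) (s t : α) : Prop :=
  ∀ v ∈ V(G), Xor (G.Communicates v s) (G.Communicates v t)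

/-- The operational states for split reliability: the sets `F` of edges of `G` such that in the
spanning subgraph with edge set `F` every vertex communicates with exactly one of `s` and `t`. -/
def splitStates {α β : Type*} (G : Graph α β) (s t : α) : Set (Set β) :=
  {F | F ⊆ E(G) ∧ (G.restrict F).IsSplit s t}

/-- The split reliability of a finite multigraph `G` with terminals `s` and `t`: the probability
that the set of operational edges is an operational state, when each edge is operational
independently with probability `p`. -/
noncomputable def splitReliability {α β : Type*} (G : Graph α β) (s t : α) (p : ℝ) : ℝ :=
  ∑ᶠ F ∈ G.splitStates s t, p ^ F.ncard * (1 - p) ^ (E(G) \ F).ncard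

/-- `G` is a connected loopless multigraph with exactly `n` vertices and `m` edges, and `s`, `t`
are two distinct vertices of it. (`Set.encard` is used so that infinite sets are excluded.) -/
structure IsTerminalGraph {α β : Type*} (n m : ℕ) (G : Graph α β) (s t : α) : Prop where
  loopless : G.Loopless
  order : V(G).encard = n
  size : E(G).encard = m
  connected : G.IsConnected
  left_mem : s ∈ V(G)
  right_mem : t ∈ V(G)
  ne : s ≠ t

/-- `G` with terminals `s`, `t` is an optimal `(n, m)`-graph for split reliability. -/
def IsOptimal {α β : Type} (n m : ℕ) (G : Graph α β) (s t : α) : Prop :=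
  IsTerminalGraph n m G s t ∧
    ∀ (α' β' : Type) (H : Graph α' β') (s' t' : α'), IsTerminalGraph n m H s' t' →
      ∀ p ∈ Set.Ioo (0 : ℝ) 1, H.splitReliability s' t' p ≤ G.splitReliability s t p

end Graph

/-!
In the basis `p ^ i * (1 - p) ^ (m - i)` the coefficients of the split reliability are the numbers
of split states with `i` edges, which vanish unless `n - 2 ≤ i ≤ m - 1`. Letting `p` tend to `0`
and to `1`, an optimal graph must maximise both the lowest and the highest of them.

The highest coefficient counts the bridges that separate the terminals. The chain, a path of `n - 2`
edges followed by a bundle of parallel edges, has `n - 2` of them, hence so has an optimal graph.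
Since a split state misses at most one separating bridge, the lowest coefficient is then at most
`(n - 2) * (m - n + 2) + 1`, which a path of `n - 3` edges followed by a triangle with one multiple
edge exceeds outside the exceptional cases. In these, the chain maximises every coefficient.
-/

namespace SplitReliability

open Graph

section Connectivity

variable {α β : Type*} {G : Graph α β} {F F' : Set β} {s t u v x y : α} {e : β}

lemma communicates_symm (h : G.Communicates x y) : G.Communicates y x := by
  induction h with
  | refl => exact .refl
  | tail _ h ih => exact .head h.symm ih

lemma communicates_comm : G.Communicates x y ↔ G.Communicates y x :=
  ⟨communicates_symm, communicates_symm⟩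

lemma communicates_restrict_of_isLink (he : e ∈ F) (h : G.IsLink e x y) :
    (G.restrict F).Communicates x y :=
  .single ⟨e, he, h⟩

lemma communicates_restrict_mono (hF : F ⊆ F') (h : (G.restrict F).Communicates x y) :
    (G.restrict F').Communicates x y :=
  Relation.ReflTransGen.mono (fun _ _ ⟨e, he, hl⟩ ↦ ⟨e, hF he, hl⟩) _ _ h

lemma mem_of_communicates {S : Set α} (hS : ∀ e u v, G.IsLink e u v → u ∈ S → v ∈ S)
    (h : G.Communicates x y) (hx : x ∈ S) : y ∈ S := by
  induction h with
  | refl => exact hx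
  | tail _ h ih => exact hS _ _ _ h.choose_spec ih

lemma communicates_empty_iff : (G.restrict ∅).Communicates x y ↔ x = y :=
  ⟨fun h ↦ (mem_of_communicates (S := {x}) (by simp) h rfl).symm, fun h ↦ h ▸ .refl⟩

lemma communicates_iff_eq_of_notMem_vertexSet (hx : x ∉ V(G)) : G.Communicates x y ↔ x = y :=
  ⟨fun h ↦ (mem_of_communicates (S := {x})
    (fun _ _ _ hl hu ↦ absurd (hu ▸ hl.left_mem) hx) h rfl).symm, fun h ↦ h ▸ .refl⟩

lemma communicates_restrict_insert_iff (hl : G.IsLink e x y) :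
    (G.restrict (insert e F)).Communicates u v ↔ (G.restrict F).Communicates u v ∨
      (G.restrict F).Communicates u x ∧ (G.restrict F).Communicates y v ∨
      (G.restrict F).Communicates u y ∧ (G.restrict F).Communicates x v := by
  have hmono : ∀ {a b}, (G.restrict F).Communicates a b →
      (G.restrict (insert e F)).Communicates a b :=
    communicates_restrict_mono (Set.subset_insert e F)
  have hxy : (G.restrict (insert e F)).Communicates x y :=
    communicates_restrict_of_isLink (.inl rfl) hl
  refine ⟨fun h ↦ ?_, ?_⟩
  · induction h with
    | refl => exact .inl .refl
    | tail _ h ih =>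
      obtain ⟨f, rfl | hf, hbc⟩ := h
      · rcases hl.eq_and_eq_or_eq_and_eq hbc with ⟨rfl, rfl⟩ | ⟨rfl, rfl⟩
        · rcases ih with hub | ⟨hux, hyx⟩ | ⟨huy, -⟩
          · exact .inr (.inl ⟨hub, .refl⟩)
          · exact .inl (hux.trans (communicates_symm hyx))
          · exact .inl huy
        · rcases ih with hub | ⟨hux, -⟩ | ⟨huy, hxy⟩
          · exact .inr (.inr ⟨hub, .refl⟩)
          · exact .inl hux
          · exact .inl (huy.trans (communicates_symm hxy))
      · have hbc := communicates_restrict_of_isLink hf hbc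
        exact ih.imp (.trans · hbc) (.imp (.imp_right (.trans · hbc)) (.imp_right (.trans · hbc)))
  · rintro (h | ⟨hux, hyv⟩ | ⟨huy, hxv⟩)
    · exact hmono h
    · exact (hmono hux).trans (hxy.trans (hmono hyv))
    · exact (hmono huy).trans ((communicates_symm hxy).trans (hmono hxv))

lemma exists_isLink_mem_notMem (hG : G.IsConnected) {S : Set α} (hx : x ∈ V(G)) (hy : y ∈ V(G))
    (hxS : x ∈ S) (hyS : y ∉ S) : ∃ e u v, G.IsLink e u v ∧ u ∈ S ∧ v ∉ S := by
  by_contra! h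
  exact hyS (mem_of_communicates h (hG.2 x hx y hy) hxS)

lemma isConnected_of_forall_communicates (hs : s ∈ V(G)) (h : ∀ v ∈ V(G), G.Communicates v s) :
    G.IsConnected :=
  ⟨⟨s, hs⟩, fun x hx y hy ↦ (h x hx).trans (communicates_symm (h y hy))⟩

lemma not_communicates_of_isSplit (hs : s ∈ V(G)) (h : G.IsSplit s t) : ¬ G.Communicates s t := by
  rcases h s hs with h | h
  · exact h.2
  · exact absurd .refl h.2

lemma isSplit_iff (hs : s ∈ V(G)) : G.IsSplit s t ↔
    ¬ G.Communicates s t ∧ ∀ v ∈ V(G), G.Communicates v s ∨ G.Communicates v t := by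
  refine ⟨fun h ↦ ⟨not_communicates_of_isSplit hs h, fun v hv ↦ (h v hv).or⟩, fun h v hv ↦ ?_⟩
  have hst : ¬ (G.Communicates v s ∧ G.Communicates v t) :=
    fun hv ↦ h.1 ((communicates_symm hv.1).trans hv.2)
  exact xor_iff_or_and_not_and _ _ |>.2 ⟨h.2 v hv, hst⟩

lemma encard_vertexSet_le_add (hF : F.Finite) (hFE : F ⊆ E(G)) (W : Set α)
    (h : ∀ v ∈ V(G), ∃ w ∈ W, (G.restrict F).Communicates v w) :
    V(G).encard ≤ W.encard + F.encard := by
  induction F, hF using Set.Finite.induction_on generalizing W with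
  | empty =>
    refine le_add_right (Set.encard_le_encard fun v hv ↦ ?_)
    obtain ⟨w, hw, hvw⟩ := h v hv
    rwa [communicates_empty_iff.1 hvw]
  | @insert e F he _ ih =>
    obtain ⟨x, y, hxy⟩ := G.exists_isLink_of_mem_edgeSet (hFE (.inl rfl))
    suffices H : ∃ z, ∀ v ∈ V(G), ∃ w ∈ insert z W, (G.restrict F).Communicates v w by
      obtain ⟨z, hz⟩ := H
      rw [Set.encard_insert_of_notMem he, add_comm F.encard, ← add_assoc]
      exact (ih ((Set.subset_insert e F).trans hFE) _ hz).trans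
        (by gcongr; exact Set.encard_insert_le W z)
    simp only [communicates_restrict_insert_iff hxy] at h
    -- Deleting `e` only separates the end of `e` that was reaching `W` through the other one.
    by_cases hx : ∃ w ∈ W, (G.restrict F).Communicates x w
    · obtain ⟨a, ha, hxa⟩ := hx
      refine ⟨y, fun v hv ↦ ?_⟩
      obtain ⟨w, hw, hvw | ⟨hvx, -⟩ | ⟨hvy, -⟩⟩ := h v hv
      · exact ⟨w, .inr hw, hvw⟩
      · exact ⟨a, .inr ha, hvx.trans hxa⟩
      · exact ⟨y, .inl rfl, hvy⟩
    · refine ⟨x, fun v hv ↦ ?_⟩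
      obtain ⟨w, hw, hvw | ⟨hvx, -⟩ | ⟨-, hxw⟩⟩ := h v hv
      · exact ⟨w, .inr hw, hvw⟩
      · exact ⟨x, .inl rfl, hvx⟩
      · exact absurd ⟨w, hw, hxw⟩ hx

end Connectivity

section LevelCount

variable {β : Type*} {𝒮 𝒯 : Set (Set β)} {A B E F : Set β} {e x : β} {i : ℕ}

/-- The number of members of a family of sets that have exactly `i` elements. For the family of
split states, these numbers are the coefficients of the split reliability in the basis
`p ^ i * (1 - p) ^ (m - i)`. -/
noncomputable def levelCard (𝒮 : Set (Set β)) (i : ℕ) : ℕ :=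
  {F ∈ 𝒮 | F.ncard = i}.ncard

lemma levelCard_mono (h𝒯 : 𝒯.Finite) (h : 𝒮 ⊆ 𝒯) (i : ℕ) : levelCard 𝒮 i ≤ levelCard 𝒯 i :=
  Set.ncard_le_ncard (fun _ hF ↦ ⟨h hF.1, hF.2⟩) (h𝒯.subset (Set.sep_subset _ _))

lemma levelCard_union_le (𝒮 𝒯 : Set (Set β)) (i : ℕ) :
    levelCard (𝒮 ∪ 𝒯) i ≤ levelCard 𝒮 i + levelCard 𝒯 i :=
  (congrArg Set.ncard Set.sep_union).trans_le (Set.ncard_union_le _ _)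

lemma levelCard_eq_zero (h : ∀ F ∈ 𝒮, F.ncard ≠ i) : levelCard 𝒮 i = 0 := by
  rw [levelCard, Set.sep_eq_empty_iff_mem_false.2 h, Set.ncard_empty]

lemma levelCard_powerset (hA : A.Finite) (i : ℕ) : levelCard (𝒫 A) i = A.ncard.choose i :=
  Set.ncard_powerset_ncard hA i

lemma levelCard_le_choose (hE : E.Finite) (h𝒮 : 𝒮 ⊆ 𝒫 E) (i : ℕ) :
    levelCard 𝒮 i ≤ E.ncard.choose i :=
  (levelCard_mono hE.powerset h𝒮 i).trans_eq (levelCard_powerset hE i)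

lemma levelCard_lt_choose (hE : E.Finite) (h𝒮 : 𝒮 ⊆ 𝒫 E) (hAE : A ⊆ E) (hA : A ∉ 𝒮) :
    levelCard 𝒮 A.ncard < E.ncard.choose A.ncard := by
  rw [← levelCard_powerset hE]
  refine Set.ncard_lt_ncard ⟨fun F hF ↦ ⟨h𝒮 hF.1, hF.2⟩, fun hsub ↦ ?_⟩
    (hE.powerset.subset (Set.sep_subset _ _))
  exact hA (hsub ⟨hAE, rfl⟩).1

lemma levelCard_union (h𝒮 : 𝒮.Finite) (h𝒯 : 𝒯.Finite) (h : Disjoint 𝒮 𝒯) (i : ℕ) :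
    levelCard (𝒮 ∪ 𝒯) i = levelCard 𝒮 i + levelCard 𝒯 i :=
  (congrArg Set.ncard Set.sep_union).trans <| Set.ncard_union_eq
    (h.mono (Set.sep_subset _ _) (Set.sep_subset _ _)) (h𝒮.subset (Set.sep_subset _ _))
    (h𝒯.subset (Set.sep_subset _ _))

lemma levelCard_image_insert (hE : E.Finite) (he : e ∉ E) (h𝒮 : 𝒮 ⊆ 𝒫 E) (i : ℕ) :
    levelCard (insert e '' 𝒮) (i + 1) = levelCard 𝒮 i := by
  have hinj : Set.InjOn (insert e) 𝒮 := fun F hF F' hF' h ↦ by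
    rw [← Set.insert_sdiff_self_of_notMem fun h ↦ he (h𝒮 hF h), h,
      Set.insert_sdiff_self_of_notMem fun h ↦ he (h𝒮 hF' h)]
  have hcard : ∀ F ∈ 𝒮, (insert e F).ncard = F.ncard + 1 := fun F hF ↦
    Set.ncard_insert_of_notMem (fun h ↦ he (h𝒮 hF h)) (hE.subset (h𝒮 hF))
  have himage : {F ∈ insert e '' 𝒮 | F.ncard = i + 1} = insert e '' {F ∈ 𝒮 | F.ncard = i} := by
    ext F
    constructor
    · rintro ⟨⟨F, hF, rfl⟩, hFi⟩
      exact ⟨F, ⟨hF, Nat.succ_injective ((hcard F hF).symm.trans hFi)⟩, rfl⟩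
    · rintro ⟨F, ⟨hF, rfl⟩, rfl⟩
      exact ⟨⟨F, hF, rfl⟩, hcard F hF⟩
  rw [levelCard, himage, (hinj.mono (Set.sep_subset _ _)).ncard_image, levelCard]

lemma eq_union_image_insert (h𝒮 : 𝒮 ⊆ 𝒫 (insert e E)) :
    𝒮 = {F | F ⊆ E ∧ F ∈ 𝒮} ∪ insert e '' {F | F ⊆ E ∧ insert e F ∈ 𝒮} := by
  refine Set.Subset.antisymm (fun F hF ↦ ?_) (Set.union_subset (fun F hF ↦ hF.2) ?_)
  · by_cases heF : e ∈ F
    · have hins : insert e (F \ {e}) = F := by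
        rw [Set.insert_sdiff_singleton, Set.insert_eq_of_mem heF]
      exact .inr ⟨F \ {e}, ⟨Set.sdiff_singleton_subset_iff.2 (h𝒮 hF), hins.symm ▸ hF⟩, hins⟩
    · exact .inl ⟨(Set.subset_insert_iff_of_notMem heF).1 (h𝒮 hF), hF⟩
  · rintro _ ⟨F, hF, rfl⟩
    exact hF.2

lemma levelCard_succ (hE : E.Finite) (he : e ∉ E) (h𝒮 : 𝒮 ⊆ 𝒫 (insert e E)) (i : ℕ) :
    levelCard 𝒮 (i + 1) =
      levelCard {F | F ⊆ E ∧ F ∈ 𝒮} (i + 1) + levelCard {F | F ⊆ E ∧ insert e F ∈ 𝒮} i := by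
  have hfin : ∀ {p : Set β → Prop}, {F | F ⊆ E ∧ p F}.Finite :=
    hE.powerset.subset fun F hF ↦ hF.1
  have hdisj : Disjoint {F | F ⊆ E ∧ F ∈ 𝒮} (insert e '' {F | F ⊆ E ∧ insert e F ∈ 𝒮}) := by
    rw [Set.disjoint_left]
    rintro _ hF ⟨F, -, rfl⟩
    exact he (hF.1 (Set.mem_insert e F))
  conv_lhs => rw [eq_union_image_insert h𝒮, levelCard_union hfin (hfin.image _) hdisj,
    levelCard_image_insert hE he fun F hF ↦ hF.1]

lemma exists_eq_insert_sdiff_singleton (hB : B.Finite) (hF : F.Finite) (hcard : F.ncard = B.ncard)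
    (hne : F ≠ B) (h : B ⊆ insert x F) : ∃ b ∈ B, ∃ y ∈ F \ B, F = insert y (B \ {b}) := by
  have hBF : (B \ F).ncard = 1 := by
    refine le_antisymm ?_ ((Set.ncard_pos hB.sdiff).2 ?_)
    · rw [← Set.ncard_singleton x]
      exact Set.ncard_le_ncard fun b hb ↦ (h hb.1).resolve_right hb.2
    · rw [Set.sdiff_nonempty]
      exact fun hBF ↦ hne (Set.eq_of_subset_of_ncard_le hBF hcard.le hF).symm
  have hFB : (F \ B).ncard = 1 := by
    rw [← hBF, ← Set.ncard_eq_ncard_iff_ncard_sdiff_eq_ncard_sdiff hF hB, hcard]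
  obtain ⟨b, hb⟩ := Set.ncard_eq_one.1 hBF
  obtain ⟨y, hy⟩ := Set.ncard_eq_one.1 hFB
  refine ⟨b, (hb ▸ Set.mem_singleton b : b ∈ B \ F).1, y, hy ▸ Set.mem_singleton y, ?_⟩
  rw [Set.insert_eq, ← hy, ← hb, Set.sdiff_sdiff_right_self, Set.inter_comm, Set.sdiff_union_inter]

lemma levelCard_le_of_subset_insert (hE : E.Finite) (hB : B ⊆ E) (h𝒮 : 𝒮 ⊆ 𝒫 E)
    (h : ∀ F ∈ 𝒮, ∃ x, B ⊆ insert x F) :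
    levelCard 𝒮 B.ncard ≤ B.ncard * (E \ B).ncard + 1 := by
  have hBfin : B.Finite := hE.subset hB
  have hfin : (B ×ˢ (E \ B)).Finite := hBfin.prod hE.sdiff
  let swap : β × β → Set β := fun q ↦ insert q.2 (B \ {q.1})
  have hsub : {F ∈ 𝒮 | F.ncard = B.ncard} ⊆ insert B (swap '' (B ×ˢ (E \ B))) := by
    rintro F ⟨hF, hFB⟩
    rw [Set.mem_insert_iff, or_iff_not_imp_left]
    intro hne
    obtain ⟨x, hx⟩ := h F hF
    obtain ⟨b, hb, y, hy, hFby⟩ :=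
      exists_eq_insert_sdiff_singleton hBfin (hE.subset (h𝒮 hF)) hFB hne hx
    exact ⟨(b, y), ⟨hb, h𝒮 hF hy.1, hy.2⟩, hFby.symm⟩
  calc levelCard 𝒮 B.ncard ≤ (insert B (swap '' (B ×ˢ (E \ B)))).ncard :=
        Set.ncard_le_ncard hsub ((hfin.image swap).insert B)
    _ ≤ (swap '' (B ×ˢ (E \ B))).ncard + 1 := Set.ncard_insert_le _ _
    _ ≤ (B ×ˢ (E \ B)).ncard + 1 := by gcongr; exact Set.ncard_image_le hfin
    _ = B.ncard * (E \ B).ncard + 1 := by rw [Set.ncard_prod]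

end LevelCount

section TerminalGraph

variable {α β α' β' : Type*} {G : Graph α β} {H : Graph α' β'} {F : Set β} {s t : α} {s' t' : α'}
  {n m i : ℕ}

/-- The sets `F` of edges of `G` for which the spanning subgraph with edge set `F` is connected. -/
def connectedStates (G : Graph α β) : Set (Set β) :=
  {F | F ⊆ E(G) ∧ (G.restrict F).IsConnected}

lemma mem_splitStates_iff (hs : s ∈ V(G)) : F ∈ G.splitStates s t ↔ F ⊆ E(G) ∧
    ¬ (G.restrict F).Communicates s t ∧
    ∀ v ∈ V(G), (G.restrict F).Communicates v s ∨ (G.restrict F).Communicates v t :=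
  and_congr_right fun _ ↦ isSplit_iff hs

lemma mem_connectedStates_iff (hs : s ∈ V(G)) : F ∈ connectedStates G ↔
    F ⊆ E(G) ∧ ∀ v ∈ V(G), (G.restrict F).Communicates v s :=
  and_congr_right fun _ ↦
    ⟨fun h v hv ↦ h.2 v hv s hs, isConnected_of_forall_communicates (G := G.restrict F) hs⟩

lemma edgeSet_mem_connectedStates_iff : E(G) ∈ connectedStates G ↔ G.IsConnected := by
  simp only [connectedStates, Set.mem_ofPred_eq, subset_rfl, restrict_self, true_and]

lemma splitReliability_eq_sum_levelCard (hE : E(G).Finite) (p : ℝ) :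
    G.splitReliability s t p = ∑ i ∈ Finset.range (E(G).ncard + 1),
      levelCard (G.splitStates s t) i * (p ^ i * (1 - p) ^ (E(G).ncard - i)) := by
  classical
  have hfin : (G.splitStates s t).Finite := hE.powerset.subset fun _ hF ↦ hF.1
  have hmaps : ∀ F ∈ hfin.toFinset, F.ncard ∈ Finset.range (E(G).ncard + 1) := fun F hF ↦
    Finset.mem_range_succ_iff.2 (Set.ncard_le_ncard (hfin.mem_toFinset.1 hF).1 hE)
  rw [Graph.splitReliability, finsum_mem_eq_finite_toFinset_sum _ hfin,
    ← Finset.sum_fiberwise_of_maps_to hmaps]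
  refine Finset.sum_congr rfl fun i _ ↦ ?_
  have hcard : levelCard (G.splitStates s t) i = (hfin.toFinset.filter (·.ncard = i)).card := by
    rw [levelCard, ← Set.ncard_coe_finset, Finset.coe_filter]
    simp only [hfin.mem_toFinset]
  rw [hcard, ← nsmul_eq_mul]
  refine Finset.sum_eq_card_nsmul fun F hF ↦ ?_
  obtain ⟨hFmem, rfl⟩ := Finset.mem_filter.1 hF
  have hFE : F ⊆ E(G) := (hfin.mem_toFinset.1 hFmem).1
  rw [Set.ncard_sdiff hFE (hE.subset hFE)]

lemma finite_edgeSet (h : IsTerminalGraph n m G s t) : E(G).Finite :=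
  Set.finite_of_encard_eq_coe h.size

lemma ncard_edgeSet (h : IsTerminalGraph n m G s t) : E(G).ncard = m := by
  rw [Set.ncard_def, h.size, ENat.toNat_natCast]

lemma splitReliability_eq (h : IsTerminalGraph n m G s t) (p : ℝ) :
    G.splitReliability s t p = ∑ i ∈ Finset.range (m + 1),
      levelCard (G.splitStates s t) i * (p ^ i * (1 - p) ^ (m - i)) := by
  rw [splitReliability_eq_sum_levelCard (finite_edgeSet h), ncard_edgeSet h]

lemma splitReliability_le (hG : IsTerminalGraph n m G s t) (hH : IsTerminalGraph n m H s' t')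
    (h : ∀ i, levelCard (H.splitStates s' t') i ≤ levelCard (G.splitStates s t) i) {p : ℝ}
    (hp : p ∈ Set.Ioo (0 : ℝ) 1) : H.splitReliability s' t' p ≤ G.splitReliability s t p := by
  rw [splitReliability_eq hG, splitReliability_eq hH]
  have hp₀ : 0 ≤ p := hp.1.le
  have hp₁ : 0 ≤ 1 - p := sub_nonneg.2 hp.2.le
  gcongr with i
  exact h i

lemma le_ncard_add_two (h : IsTerminalGraph n m G s t) (hF : F ∈ G.splitStates s t) :
    n ≤ F.ncard + 2 := by
  have hle := encard_vertexSet_le_add ((finite_edgeSet h).subset hF.1) hF.1 {s, t} fun v hv ↦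
    (hF.2 v hv).or.elim (⟨s, .inl rfl, ·⟩) (⟨t, .inr rfl, ·⟩)
  rw [h.order, Set.encard_pair h.ne, ← ((finite_edgeSet h).subset hF.1).cast_ncard_eq,
    add_comm] at hle
  exact_mod_cast hle

lemma not_communicates_of_mem_splitStates (hs : s ∈ V(G)) (hF : F ∈ G.splitStates s t) :
    ¬ (G.restrict F).Communicates s t :=
  not_communicates_of_isSplit hs hF.2

lemma ncard_lt_of_mem_splitStates (h : IsTerminalGraph n m G s t) (hF : F ∈ G.splitStates s t) :
    F.ncard < m := by
  rw [← ncard_edgeSet h]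
  refine Set.ncard_lt_ncard (hF.1.ssubset_of_ne ?_) (finite_edgeSet h)
  rintro rfl
  refine not_communicates_of_mem_splitStates h.left_mem hF ?_
  rw [restrict_self]
  exact h.connected.2 s h.left_mem t h.right_mem

lemma levelCard_splitStates_of_lt (h : IsTerminalGraph n m G s t) (hi : i + 2 < n) :
    levelCard (G.splitStates s t) i = 0 :=
  levelCard_eq_zero fun _ hF hFi ↦ (hFi ▸ le_ncard_add_two h hF).not_gt hi

lemma levelCard_splitStates_of_size_le (h : IsTerminalGraph n m G s t) (hi : m ≤ i) :
    levelCard (G.splitStates s t) i = 0 :=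
  levelCard_eq_zero fun _ hF hFi ↦ (hFi ▸ ncard_lt_of_mem_splitStates h hF).not_ge hi

lemma levelCard_splitStates_le_choose (h : IsTerminalGraph n m G s t) (i : ℕ) :
    levelCard (G.splitStates s t) i ≤ m.choose i :=
  ncard_edgeSet h ▸ levelCard_le_choose (finite_edgeSet h) (fun _ hF ↦ hF.1) i

end TerminalGraph

section Coefficients

variable {α β α' β' : Type*} {G : Graph α β} {H : Graph α' β'} {s t : α} {s' t' : α'}
  {n m r k i : ℕ} {d : ℕ → ℝ}

lemma coeff_zero_nonneg (h : ∀ p ∈ Set.Ioo (0 : ℝ) 1,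
    0 ≤ ∑ i ∈ Finset.range (r + 1), d i * (p ^ i * (1 - p) ^ (r - i))) : 0 ≤ d 0 := by
  set f : ℝ → ℝ := fun p ↦ ∑ i ∈ Finset.range (r + 1), d i * (p ^ i * (1 - p) ^ (r - i)) with hf
  have hcont : Continuous f := by fun_prop
  have hf₀ : f 0 = d 0 := by simp [hf, Finset.sum_range_succ']
  have hmem : (0 : ℝ) ∈ closure (Set.Ioo 0 1) := by
    rw [closure_Ioo zero_ne_one]
    exact Set.left_mem_Icc.2 zero_le_one
  exact hf₀ ▸ closure_minimal (t := f ⁻¹' Set.Ici 0) h (isClosed_Ici.preimage hcont) hmem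

lemma lowest_coeff_nonneg (hd : ∀ i < k, d i = 0)
    (h : ∀ p ∈ Set.Ioo (0 : ℝ) 1,
      0 ≤ ∑ i ∈ Finset.range (k + r + 1), d i * (p ^ i * (1 - p) ^ (k + r - i))) : 0 ≤ d k := by
  refine coeff_zero_nonneg (d := fun i ↦ d (k + i)) (r := r) fun p hp ↦ ?_
  refine nonneg_of_mul_nonneg_right ((h p hp).trans_eq ?_) (pow_pos hp.1 k)
  have hlow : ∑ i ∈ Finset.range k, d i * (p ^ i * (1 - p) ^ (k + r - i)) = 0 :=
    Finset.sum_eq_zero fun i hi ↦ by rw [hd i (Finset.mem_range.1 hi), zero_mul]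
  rw [add_assoc, Finset.sum_range_add, hlow, zero_add, Finset.mul_sum]
  refine Finset.sum_congr rfl fun i _ ↦ ?_
  rw [Nat.add_sub_add_left, pow_add]
  ring

lemma highest_coeff_nonneg (hd : ∀ i ≤ k + r, k < i → d i = 0)
    (h : ∀ p ∈ Set.Ioo (0 : ℝ) 1,
      0 ≤ ∑ i ∈ Finset.range (k + r + 1), d i * (p ^ i * (1 - p) ^ (k + r - i))) : 0 ≤ d k := by
  have hreflect := lowest_coeff_nonneg (d := fun i ↦ d (k + r - i)) (k := r) (r := k)
    (fun i hi ↦ hd _ (Nat.sub_le _ _) (by omega)) fun p hp ↦ ?_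
  · simpa only [Nat.add_sub_cancel] using hreflect
  · refine (h (1 - p) ⟨sub_pos.2 hp.2, sub_lt_self 1 hp.1⟩).trans_eq ?_
    rw [← Finset.sum_range_reflect, add_comm r k]
    refine Finset.sum_congr rfl fun i hi ↦ ?_
    have hi : i ≤ k + r := Finset.mem_range_succ_iff.1 hi
    rw [Nat.add_sub_cancel, Nat.sub_sub_self hi, sub_sub_cancel, mul_comm (p ^ i)]

lemma sum_levelCard_sub_nonneg (hG : IsTerminalGraph n m G s t) (hH : IsTerminalGraph n m H s' t')
    {p : ℝ} (h : H.splitReliability s' t' p ≤ G.splitReliability s t p) :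
    0 ≤ ∑ i ∈ Finset.range (m + 1),
      ((levelCard (G.splitStates s t) i : ℝ) - levelCard (H.splitStates s' t') i) *
        (p ^ i * (1 - p) ^ (m - i)) := by
  simp only [sub_mul, Finset.sum_sub_distrib]
  rwa [← splitReliability_eq hG, ← splitReliability_eq hH, sub_nonneg]

lemma levelCard_lowest_le (hG : IsTerminalGraph (i + 2) (i + r) G s t)
    (hH : IsTerminalGraph (i + 2) (i + r) H s' t')
    (h : ∀ p ∈ Set.Ioo (0 : ℝ) 1, H.splitReliability s' t' p ≤ G.splitReliability s t p) :
    levelCard (H.splitStates s' t') i ≤ levelCard (G.splitStates s t) i := by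
  refine Nat.cast_le.1 (sub_nonneg.1 (lowest_coeff_nonneg (fun j hj ↦ ?_)
    fun p hp ↦ sum_levelCard_sub_nonneg hG hH (h p hp)))
  rw [levelCard_splitStates_of_lt hG (by omega), levelCard_splitStates_of_lt hH (by omega),
    sub_self]

lemma levelCard_highest_le (hG : IsTerminalGraph n (i + 1) G s t)
    (hH : IsTerminalGraph n (i + 1) H s' t')
    (h : ∀ p ∈ Set.Ioo (0 : ℝ) 1, H.splitReliability s' t' p ≤ G.splitReliability s t p) :
    levelCard (H.splitStates s' t') i ≤ levelCard (G.splitStates s t) i := by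
  refine Nat.cast_le.1 (sub_nonneg.1 (highest_coeff_nonneg (fun j _ hj ↦ ?_)
    fun p hp ↦ sum_levelCard_sub_nonneg hG hH (h p hp)))
  rw [levelCard_splitStates_of_size_le hG hj, levelCard_splitStates_of_size_le hH hj, sub_self]

end Coefficients

section AddEdge

variable {α β : Type*} {G : Graph α β} {F : Set β} {u v x y : α} {e : β}

/-- The graph obtained from `G` by adding an edge `e` with ends `x` and `y`, which are added to the
vertices if necessary. If `e` already is an edge of `G`, it is moved. -/
def addEdge (G : Graph α β) (e : β) (x y : α) : Graph α β where
  vertexSet := insert x (insert y V(G))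
  edgeSet := insert e E(G)
  IsLink f u v := f = e ∧ (u = x ∧ v = y ∨ u = y ∧ v = x) ∨ f ≠ e ∧ G.IsLink f u v
  isLink_symm _ _ := ⟨fun _ _ h ↦
    h.imp (.imp_right fun h ↦ h.symm.imp And.symm And.symm) (.imp_right IsLink.symm)⟩
  eq_or_eq_of_isLink_of_isLink := by
    rintro f a b c d (⟨hf, h⟩ | ⟨hf, h⟩) (⟨hf', h'⟩ | ⟨hf', h'⟩)
    · grind
    · exact absurd hf hf'
    · exact absurd hf' hf
    · exact h.left_eq_or_eq h'
  edge_mem_iff_exists_isLink f := by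
    by_cases hf : f = e
    · simp only [hf, Set.mem_insert_iff, true_or, true_iff]
      exact ⟨x, y, .inl ⟨trivial, .inl ⟨rfl, rfl⟩⟩⟩
    · simp [hf, G.edge_mem_iff_exists_isLink]
  left_mem_of_isLink := by
    rintro f a b (⟨-, ⟨rfl, -⟩ | ⟨rfl, -⟩⟩ | ⟨-, h⟩)
    · exact .inl rfl
    · exact .inr (.inl rfl)
    · exact .inr (.inr h.left_mem)

lemma isLink_addEdge_self : (addEdge G e x y).IsLink e x y :=
  .inl ⟨rfl, .inl ⟨rfl, rfl⟩⟩

lemma loopless_addEdge (hG : G.Loopless) (hxy : x ≠ y) : (addEdge G e x y).Loopless := by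
  refine ⟨fun f v h ↦ ?_⟩
  rcases h with ⟨-, ⟨rfl, rfl⟩ | ⟨rfl, rfl⟩⟩ | ⟨-, h⟩
  · exact hxy rfl
  · exact hxy rfl
  · exact hG.not_isLoopAt f v h

lemma communicates_addEdge_iff (he : e ∉ F) :
    ((addEdge G e x y).restrict F).Communicates u v ↔ (G.restrict F).Communicates u v := by
  have hadj : ((addEdge G e x y).restrict F).Adj = (G.restrict F).Adj := by
    ext u v
    refine exists_congr fun f ↦ and_congr_right fun hf ↦ ?_
    have hfe : f ≠ e := fun h ↦ he (h ▸ hf)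
    simp [addEdge, hfe]
  rw [Communicates, hadj, Communicates]

lemma communicates_addEdge_insert_iff (he : e ∉ F) :
    ((addEdge G e x y).restrict (insert e F)).Communicates u v ↔ (G.restrict F).Communicates u v ∨
      (G.restrict F).Communicates u x ∧ (G.restrict F).Communicates y v ∨
      (G.restrict F).Communicates u y ∧ (G.restrict F).Communicates x v := by
  simp only [communicates_restrict_insert_iff isLink_addEdge_self, communicates_addEdge_iff he]

end AddEdge

section PendantEdge

variable {α β : Type*} {G : Graph α β} {F : Set β} {s t u v x : α} {e : β} {n m : ℕ}

lemma not_communicates_restrict (hx : x ∉ V(G)) (hv : v ∈ V(G)) :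
    ¬ (G.restrict F).Communicates v x := fun h ↦
  hx ((communicates_iff_eq_of_notMem_vertexSet (G := G.restrict F) hx).1 (communicates_symm h) ▸ hv)

lemma communicates_pendant_iff (hx : x ∉ V(G)) (he : e ∉ F) (hu : u ∈ V(G)) (hv : v ∈ V(G)) :
    ((addEdge G e x s).restrict (insert e F)).Communicates u v ↔
      (G.restrict F).Communicates u v := by
  have hxv : ¬ (G.restrict F).Communicates x v := fun h ↦
    not_communicates_restrict hx hv (communicates_symm h)
  simp only [communicates_addEdge_insert_iff he, not_communicates_restrict hx hu, hxv, false_and,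
    and_false, or_false]

lemma communicates_pendant_left_iff (hx : x ∉ V(G)) (he : e ∉ F) (hv : v ∈ V(G)) :
    ((addEdge G e x s).restrict (insert e F)).Communicates v x ↔
      (G.restrict F).Communicates v s := by
  have hxx : (G.restrict F).Communicates x x := .refl
  simp only [communicates_addEdge_insert_iff he, not_communicates_restrict hx hv, hxx, false_and,
    and_true, false_or]

lemma forall_mem_vertexSet_pendant {p : α → Prop} (hs : s ∈ V(G)) :
    (∀ v ∈ V(addEdge G e x s), p v) ↔ p x ∧ ∀ v ∈ V(G), p v := by
  rw [show V(addEdge G e x s) = insert x V(G) from congrArg (insert x) (Set.insert_eq_of_mem hs),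
    Set.forall_mem_insert]

lemma mem_splitStates_pendant_iff (hs : s ∈ V(G)) (ht : t ∈ V(G)) (hx : x ∉ V(G)) (he : e ∉ E(G))
    (hF : F ⊆ E(G)) : F ∈ (addEdge G e x s).splitStates x t ↔ F ∈ connectedStates G := by
  have hxV : x ∈ V(addEdge G e x s) := Set.mem_insert x _
  have hFE : F ⊆ E(addEdge G e x s) := hF.trans (Set.subset_insert e _)
  have hxt : ¬ (G.restrict F).Communicates x t := fun h ↦
    not_communicates_restrict hx ht (communicates_symm h)
  have hxx : (G.restrict F).Communicates x x := .refl
  rw [mem_splitStates_iff hxV, mem_connectedStates_iff ht, forall_mem_vertexSet_pendant hs]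
  simp only [communicates_addEdge_iff fun h ↦ he (hF h), hF, hFE, hxt, hxx, not_false_eq_true,
    true_or, true_and]
  exact forall₂_congr fun v hv ↦ or_iff_right (not_communicates_restrict hx hv)

lemma insert_mem_splitStates_pendant_iff (hs : s ∈ V(G)) (ht : t ∈ V(G)) (hx : x ∉ V(G))
    (he : e ∉ E(G)) (hF : F ⊆ E(G)) :
    insert e F ∈ (addEdge G e x s).splitStates x t ↔ F ∈ G.splitStates s t := by
  have hxV : x ∈ V(addEdge G e x s) := Set.mem_insert x _
  have hFE : insert e F ⊆ E(addEdge G e x s) := Set.insert_subset_insert hF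
  have heF : e ∉ F := fun h ↦ he (hF h)
  have hxx : ((addEdge G e x s).restrict (insert e F)).Communicates x x := .refl
  rw [mem_splitStates_iff hxV, mem_splitStates_iff hs, forall_mem_vertexSet_pendant hs,
    communicates_comm, communicates_pendant_left_iff hx heF ht, communicates_comm]
  simp only [hF, hFE, hxx, true_or, true_and]
  refine and_congr_right fun _ ↦ forall₂_congr fun v hv ↦ ?_
  rw [communicates_pendant_left_iff hx heF hv, communicates_pendant_iff hx heF hv ht]

lemma notMem_connectedStates_pendant (hs : s ∈ V(G)) (hx : x ∉ V(G)) (he : e ∉ F) :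
    F ∉ connectedStates (addEdge G e x s) := by
  rw [mem_connectedStates_iff (Set.mem_insert x _), forall_mem_vertexSet_pendant hs]
  simp only [communicates_addEdge_iff he]
  exact fun h ↦ not_communicates_restrict hx hs (h.2.2 s hs)

lemma insert_mem_connectedStates_pendant_iff (hs : s ∈ V(G)) (hx : x ∉ V(G)) (he : e ∉ E(G))
    (hF : F ⊆ E(G)) : insert e F ∈ connectedStates (addEdge G e x s) ↔ F ∈ connectedStates G := by
  have hxV : x ∈ V(addEdge G e x s) := Set.mem_insert x _
  have hFE : insert e F ⊆ E(addEdge G e x s) := Set.insert_subset_insert hF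
  have hxx : ((addEdge G e x s).restrict (insert e F)).Communicates x x := .refl
  rw [mem_connectedStates_iff hxV, mem_connectedStates_iff hs, forall_mem_vertexSet_pendant hs]
  simp only [hF, hFE, hxx, true_and]
  exact forall₂_congr fun v hv ↦ communicates_pendant_left_iff hx (fun h ↦ he (hF h)) hv

lemma levelCard_splitStates_pendant (hE : E(G).Finite) (hs : s ∈ V(G)) (ht : t ∈ V(G))
    (hx : x ∉ V(G)) (he : e ∉ E(G)) (i : ℕ) :
    levelCard ((addEdge G e x s).splitStates x t) (i + 1) =
      levelCard (connectedStates G) (i + 1) + levelCard (G.splitStates s t) i := by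
  rw [levelCard_succ hE he fun _ hF ↦ hF.1]
  congr 2 <;> ext F
  · exact (and_congr_right (mem_splitStates_pendant_iff hs ht hx he)).trans
      (and_iff_right_of_imp And.left)
  · exact (and_congr_right (insert_mem_splitStates_pendant_iff hs ht hx he)).trans
      (and_iff_right_of_imp And.left)

lemma levelCard_connectedStates_pendant (hE : E(G).Finite) (hs : s ∈ V(G)) (hx : x ∉ V(G))
    (he : e ∉ E(G)) (i : ℕ) :
    levelCard (connectedStates (addEdge G e x s)) (i + 1) = levelCard (connectedStates G) i := by
  rw [levelCard_succ hE he fun _ hF ↦ hF.1, levelCard_eq_zero, zero_add]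
  · congr 1
    ext F
    exact (and_congr_right (insert_mem_connectedStates_pendant_iff hs hx he)).trans
      (and_iff_right_of_imp And.left)
  · exact fun F hF ↦ absurd hF.2 (notMem_connectedStates_pendant hs hx fun h ↦ he (hF.1 h))

lemma isTerminalGraph_pendant (h : IsTerminalGraph n m G s t) (hx : x ∉ V(G)) (he : e ∉ E(G)) :
    IsTerminalGraph (n + 1) (m + 1) (addEdge G e x s) x t where
  loopless := loopless_addEdge h.loopless fun hxs ↦ hx (hxs ▸ h.left_mem)
  order := by
    change (insert x (insert s V(G))).encard = _
    rw [Set.insert_eq_of_mem h.left_mem, Set.encard_insert_of_notMem hx, h.order]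
    rfl
  size := (Set.encard_insert_of_notMem he).trans (by rw [h.size]; rfl)
  connected := edgeSet_mem_connectedStates_iff.1 <|
    (insert_mem_connectedStates_pendant_iff h.left_mem hx he subset_rfl).2 <|
    edgeSet_mem_connectedStates_iff.2 h.connected
  left_mem := Set.mem_insert x _
  right_mem := .inr (.inr h.right_mem)
  ne := fun hxt ↦ hx (hxt ▸ h.right_mem)

end PendantEdge

section ParallelEdge

variable {α β : Type*} {G : Graph α β} {F : Set β} {s t : α} {e : β} {n m : ℕ}

lemma vertexSet_addEdge_parallel (hs : s ∈ V(G)) (ht : t ∈ V(G)) : V(addEdge G e s t) = V(G) :=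
  (Set.insert_eq_of_mem (Set.mem_insert_of_mem t hs)).trans (Set.insert_eq_of_mem ht)

lemma mem_splitStates_parallel_iff (hs : s ∈ V(G)) (ht : t ∈ V(G)) (he : e ∉ E(G))
    (hF : F ⊆ E(G)) : F ∈ (addEdge G e s t).splitStates s t ↔ F ∈ G.splitStates s t := by
  have hFE : F ⊆ E(addEdge G e s t) := hF.trans (Set.subset_insert e _)
  rw [mem_splitStates_iff hs, mem_splitStates_iff (Set.mem_insert s _)]
  simp only [communicates_addEdge_iff fun h ↦ he (hF h), vertexSet_addEdge_parallel hs ht, hF, hFE]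

lemma insert_notMem_splitStates_parallel :
    insert e F ∉ (addEdge G e s t).splitStates s t := fun h ↦
  not_communicates_of_mem_splitStates (Set.mem_insert s _) h
    (communicates_restrict_of_isLink (Set.mem_insert e F) isLink_addEdge_self)

lemma mem_connectedStates_parallel_iff (hs : s ∈ V(G)) (ht : t ∈ V(G)) (he : e ∉ E(G))
    (hF : F ⊆ E(G)) : F ∈ connectedStates (addEdge G e s t) ↔ F ∈ connectedStates G := by
  have hFE : F ⊆ E(addEdge G e s t) := hF.trans (Set.subset_insert e _)
  rw [mem_connectedStates_iff hs, mem_connectedStates_iff (Set.mem_insert s _)]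
  simp only [communicates_addEdge_iff fun h ↦ he (hF h), vertexSet_addEdge_parallel hs ht, hF, hFE]

lemma insert_mem_connectedStates_parallel_iff (hs : s ∈ V(G)) (ht : t ∈ V(G)) (he : e ∉ E(G))
    (hF : F ⊆ E(G)) : insert e F ∈ connectedStates (addEdge G e s t) ↔
      F ∈ connectedStates G ∨ F ∈ G.splitStates s t := by
  have hFE : insert e F ⊆ E(addEdge G e s t) := Set.insert_subset_insert hF
  have heF : e ∉ F := fun h ↦ he (hF h)
  have hss : (G.restrict F).Communicates s s := .refl
  rw [mem_connectedStates_iff (Set.mem_insert s _), mem_connectedStates_iff hs,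
    mem_splitStates_iff hs, vertexSet_addEdge_parallel hs ht]
  simp only [communicates_addEdge_insert_iff heF, hF, hFE, hss, true_and, and_true]
  have habsorb : ∀ v, ((G.restrict F).Communicates v s ∨ (G.restrict F).Communicates v s ∧
      (G.restrict F).Communicates t s ∨ (G.restrict F).Communicates v t) ↔
      (G.restrict F).Communicates v s ∨ (G.restrict F).Communicates v t := fun v ↦ by tauto
  simp only [habsorb]
  refine ⟨fun h ↦ ?_, Or.rec (fun h v hv ↦ .inl (h v hv)) And.right⟩
  by_cases hst : (G.restrict F).Communicates s t
  · exact .inl fun v hv ↦ (h v hv).elim id (·.trans (communicates_symm hst))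
  · exact .inr ⟨hst, h⟩

lemma levelCard_splitStates_parallel (hs : s ∈ V(G)) (ht : t ∈ V(G)) (he : e ∉ E(G)) (i : ℕ) :
    levelCard ((addEdge G e s t).splitStates s t) i = levelCard (G.splitStates s t) i := by
  congr 1
  ext F
  by_cases heF : e ∈ F
  · have hins : insert e F = F := Set.insert_eq_of_mem heF
    exact iff_of_false (hins ▸ insert_notMem_splitStates_parallel) fun h ↦ he (h.1 heF)
  · refine ⟨fun h ↦ ?_, fun h ↦ (mem_splitStates_parallel_iff hs ht he h.1).2 h⟩
    exact (mem_splitStates_parallel_iff hs ht he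
      ((Set.subset_insert_iff_of_notMem heF).1 h.1)).1 h

lemma levelCard_connectedStates_parallel (hE : E(G).Finite) (hs : s ∈ V(G)) (ht : t ∈ V(G))
    (he : e ∉ E(G)) (i : ℕ) :
    levelCard (connectedStates (addEdge G e s t)) (i + 1) =
      levelCard (connectedStates G) (i + 1) +
        (levelCard (connectedStates G) i + levelCard (G.splitStates s t) i) := by
  have hconn : connectedStates G ⊆ 𝒫 E(G) := fun F hF ↦ hF.1
  have hsplit : G.splitStates s t ⊆ 𝒫 E(G) := fun F hF ↦ hF.1
  have hdisj : Disjoint (connectedStates G) (G.splitStates s t) := Set.disjoint_left.2 fun F hF h ↦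
    not_communicates_of_mem_splitStates hs h (hF.2.2 s hs t ht)
  rw [levelCard_succ hE he fun _ hF ↦ hF.1,
    ← levelCard_union (hE.powerset.subset hconn) (hE.powerset.subset hsplit) hdisj]
  congr 2 <;> ext F
  · exact (and_congr_right (mem_connectedStates_parallel_iff hs ht he)).trans
      (and_iff_right_of_imp And.left)
  · exact (and_congr_right (insert_mem_connectedStates_parallel_iff hs ht he)).trans
      (and_iff_right_of_imp (Or.rec And.left And.left))

lemma isTerminalGraph_parallel (h : IsTerminalGraph n m G s t) (he : e ∉ E(G)) :
    IsTerminalGraph n (m + 1) (addEdge G e s t) s t where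
  loopless := loopless_addEdge h.loopless h.ne
  order := by rw [vertexSet_addEdge_parallel h.left_mem h.right_mem, h.order]
  size := (Set.encard_insert_of_notMem he).trans (by rw [h.size]; rfl)
  connected := edgeSet_mem_connectedStates_iff.1 <|
    (insert_mem_connectedStates_parallel_iff h.left_mem h.right_mem he subset_rfl).2 <|
    .inl <| edgeSet_mem_connectedStates_iff.2 h.connected
  left_mem := Set.mem_insert s _
  right_mem := Set.mem_insert_of_mem s (Set.mem_insert t _)
  ne := h.ne

end ParallelEdge

section OrderTwo

variable {α β : Type*} {G : Graph α β} {s t : α} {m : ℕ}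

lemma vertexSet_eq_pair (h : IsTerminalGraph 2 m G s t) : V(G) = {s, t} := by
  refine (Set.Finite.eq_of_subset_of_encard_le' ?_ ?_ ?_).symm
  · exact Set.finite_of_encard_eq_coe h.order
  · exact Set.insert_subset h.left_mem (Set.singleton_subset_iff.2 h.right_mem)
  · rw [h.order, Set.encard_pair h.ne, Nat.cast_ofNat]

lemma isLink_of_mem_edgeSet (h : IsTerminalGraph 2 m G s t) {e : β} (he : e ∈ E(G)) :
    G.IsLink e s t := by
  obtain ⟨x, y, hl⟩ := exists_isLink_of_mem_edgeSet he
  have hx := hl.left_mem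
  have hy := hl.right_mem
  have := h.loopless
  have hxy : x ≠ y := hl.ne
  rw [vertexSet_eq_pair h] at hx hy
  rcases hx with rfl | rfl <;> rcases hy with rfl | rfl
  · exact absurd rfl hxy
  · exact hl
  · exact hl.symm
  · exact absurd rfl hxy

lemma splitStates_order_two (h : IsTerminalGraph 2 m G s t) : G.splitStates s t = {∅} := by
  ext F
  rw [mem_splitStates_iff h.left_mem, vertexSet_eq_pair h, Set.mem_singleton_iff]
  refine ⟨fun hF ↦ Set.eq_empty_of_forall_notMem fun e he ↦ hF.2.1 ?_, ?_⟩
  · exact communicates_restrict_of_isLink he (isLink_of_mem_edgeSet h (hF.1 he))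
  · rintro rfl
    refine ⟨Set.empty_subset _, communicates_empty_iff.not.2 h.ne, ?_⟩
    rintro v (rfl | rfl)
    · exact .inl .refl
    · exact .inr .refl

lemma connectedStates_order_two (h : IsTerminalGraph 2 m G s t) :
    connectedStates G = {F | F ⊆ E(G) ∧ F.Nonempty} := by
  ext F
  rw [mem_connectedStates_iff h.left_mem, vertexSet_eq_pair h]
  refine and_congr_right fun hF ↦ ⟨fun hc ↦ ?_, ?_⟩
  · rw [Set.nonempty_iff_ne_empty]
    rintro rfl
    exact h.ne.symm (communicates_empty_iff.1 (hc t (.inr rfl)))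
  · rintro ⟨e, he⟩ v (rfl | rfl)
    · exact .refl
    · exact communicates_restrict_of_isLink he (isLink_of_mem_edgeSet h (hF he)).symm

lemma levelCard_splitStates_order_two (h : IsTerminalGraph 2 m G s t) (j : ℕ) :
    levelCard (G.splitStates s t) j = if j = 0 then 1 else 0 := by
  rw [splitStates_order_two h, ← Set.powerset_empty, levelCard_powerset Set.finite_empty,
    Set.ncard_empty]
  cases j <;> simp

lemma levelCard_zero_connectedStates_order_two (h : IsTerminalGraph 2 m G s t) :
    levelCard (connectedStates G) 0 = 0 := by
  rw [connectedStates_order_two h]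
  exact levelCard_eq_zero fun F hF ↦
    ((Set.ncard_pos ((finite_edgeSet h).subset hF.1)).2 hF.2).ne'

lemma levelCard_succ_connectedStates_order_two (h : IsTerminalGraph 2 m G s t) (j : ℕ) :
    levelCard (connectedStates G) (j + 1) = m.choose (j + 1) := by
  rw [connectedStates_order_two h, ← ncard_edgeSet h, ← levelCard_powerset (finite_edgeSet h)]
  refine congrArg Set.ncard (Set.ext fun F ↦ and_congr_left fun hFj ↦ and_iff_left ?_)
  exact Set.nonempty_of_ncard_ne_zero (hFj ▸ Nat.succ_ne_zero j)

end OrderTwo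

section Constructions

variable {α β : Type*} {G : Graph α β} {s t : α} {n m k l : ℕ}

lemma isTerminalGraph_banana {E : Set β} (hst : s ≠ t) (hE : E.encard = m) (hne : E.Nonempty) :
    IsTerminalGraph 2 m (banana s t E) s t where
  loopless := ⟨fun e x h ↦ hst (banana_isLoopAt.1 h).2.2⟩
  order := Set.encard_pair hst
  size := hE
  connected := by
    obtain ⟨e, he⟩ := hne
    have hl : (banana s t E).IsLink e t s := ⟨he, .inr ⟨rfl, rfl⟩⟩
    refine isConnected_of_forall_communicates (s := s) (Set.mem_insert s _) ?_
    rintro v (rfl | rfl)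
    · exact .refl
    · exact .single ⟨e, hl⟩
  left_mem := Set.mem_insert s _
  right_mem := Set.mem_insert_of_mem s rfl
  ne := hst

lemma exists_isTerminalGraph_order_two (hm : 1 ≤ m) :
    ∃ (G : Graph ℕ ℕ) (s t : ℕ), IsTerminalGraph 2 m G s t := by
  refine ⟨_, 0, 1, isTerminalGraph_banana (E := Set.Iio m) zero_ne_one ?_ ⟨0, hm⟩⟩
  rw [← Finset.coe_Iio, Set.encard_coe_eq_coe_finsetCard, Nat.card_Iio]

lemma exists_pendant [Infinite α] [Infinite β] (h : IsTerminalGraph n m G s t) :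
    ∃ (H : Graph α β) (x : α), IsTerminalGraph (n + 1) (m + 1) H x t ∧
      (∀ i, levelCard (H.splitStates x t) (i + 1) =
        levelCard (connectedStates G) (i + 1) + levelCard (G.splitStates s t) i) ∧
      ∀ i, levelCard (connectedStates H) (i + 1) = levelCard (connectedStates G) i := by
  have hE := finite_edgeSet h
  obtain ⟨x, hx⟩ := (Set.finite_of_encard_eq_coe h.order).exists_notMem
  obtain ⟨e, he⟩ := hE.exists_notMem
  exact ⟨addEdge G e x s, x, isTerminalGraph_pendant h hx he,
    levelCard_splitStates_pendant hE h.left_mem h.right_mem hx he,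
    levelCard_connectedStates_pendant hE h.left_mem hx he⟩

lemma exists_parallel [Infinite β] (h : IsTerminalGraph n m G s t) :
    ∃ H : Graph α β, IsTerminalGraph n (m + 1) H s t ∧
      (∀ i, levelCard (H.splitStates s t) i = levelCard (G.splitStates s t) i) ∧
      ∀ i, levelCard (connectedStates H) (i + 1) = levelCard (connectedStates G) (i + 1) +
        (levelCard (connectedStates G) i + levelCard (G.splitStates s t) i) := by
  obtain ⟨e, he⟩ := (finite_edgeSet h).exists_notMem
  exact ⟨addEdge G e s t, isTerminalGraph_parallel h he,
    levelCard_splitStates_parallel h.left_mem h.right_mem he,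
    levelCard_connectedStates_parallel (finite_edgeSet h) h.left_mem h.right_mem he⟩

lemma exists_pendant_path [Infinite α] [Infinite β] (h : IsTerminalGraph n m G s t) (c : ℕ) :
    ∃ (H : Graph α β) (x : α), IsTerminalGraph (n + c) (m + c) H x t ∧
      (∀ i, levelCard (H.splitStates x t) (c + i) =
        c * levelCard (connectedStates G) (i + 1) + levelCard (G.splitStates s t) i) ∧
      ∀ i, levelCard (connectedStates H) (c + i) = levelCard (connectedStates G) i := by
  induction c with
  | zero => exact ⟨G, s, h, by simp⟩
  | succ c ih =>
    obtain ⟨H, x, hH, hsplit, hconn⟩ := ih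
    obtain ⟨H', x', hH', hsplit', hconn'⟩ := exists_pendant hH
    refine ⟨H', x', hH', fun i ↦ ?_, fun i ↦ ?_⟩
    · rw [Nat.add_right_comm, hsplit', hsplit, add_assoc c, hconn]
      ring
    · rw [Nat.add_right_comm, hconn', hconn]

/-- The number of split states with `d + j` edges of the chain, the graph with `d + 2` vertices in
which a path with `d` edges leads from one terminal to the first of two vertices joined by `k`
parallel edges, the second of which is the other terminal. -/
def chainCount (d k j : ℕ) : ℕ := d * k.choose (j + 1) + if j = 0 then 1 else 0

lemma exists_chain (d : ℕ) (hk : 1 ≤ k) :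
    ∃ (G : Graph ℕ ℕ) (s t : ℕ), IsTerminalGraph (d + 2) (d + k) G s t ∧
      ∀ j, levelCard (G.splitStates s t) (d + j) = chainCount d k j := by
  obtain ⟨G, s, t, hG⟩ := exists_isTerminalGraph_order_two hk
  obtain ⟨H, x, hH, hsplit, -⟩ := exists_pendant_path hG d
  refine ⟨H, x, t, by rwa [add_comm d, add_comm d], fun j ↦ ?_⟩
  rw [hsplit, levelCard_succ_connectedStates_order_two hG, levelCard_splitStates_order_two hG,
    chainCount]

/-- The graph that beats the chain for small `p`: a triangle with one edge replaced by `l` parallel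
edges, with a path with `c` edges attached at one end of them. -/
lemma exists_triangleChain (c : ℕ) (hl : 1 ≤ l) :
    ∃ (G : Graph ℕ ℕ) (s t : ℕ), IsTerminalGraph (c + 3) (c + l + 2) G s t ∧
      levelCard (G.splitStates s t) (c + 1) = c * (2 * l + 1) + (l + 1) := by
  obtain ⟨G₀, s₀, t, h₀⟩ := exists_isTerminalGraph_order_two hl
  obtain ⟨G₁, s, h₁, hsplit₁, hconn₁⟩ := exists_pendant h₀
  obtain ⟨G₂, h₂, hsplit₂, hconn₂⟩ := exists_parallel h₁
  obtain ⟨G₃, x, h₃, hsplit₃, -⟩ := exists_pendant_path h₂ c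
  refine ⟨G₃, x, t, by convert h₃ using 1 <;> ring, ?_⟩
  have hsplit : levelCard (G₁.splitStates s t) 1 = l + 1 := by
    simp [hsplit₁, levelCard_succ_connectedStates_order_two h₀, levelCard_splitStates_order_two h₀]
  have hconn : levelCard (connectedStates G₂) 2 = 2 * l + 1 := by
    rw [hconn₂, hconn₁, hconn₁, levelCard_zero_connectedStates_order_two h₀,
      levelCard_succ_connectedStates_order_two h₀, hsplit, Nat.choose_one_right]
    ring
  rw [hsplit₃, hconn, hsplit₂, hsplit]

end Constructions

section SplitBridges

variable {α β : Type*} {G : Graph α β} {F : Set β} {s t u v : α} {e f : β} {n m k : ℕ}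

/-- The edges of `G` whose removal leaves a split state, which are the bridges that separate `s`
from `t`. Their number is the highest coefficient of the split reliability. -/
def splitBridges (G : Graph α β) (s t : α) : Set β :=
  {e | e ∈ E(G) ∧ E(G) \ {e} ∈ G.splitStates s t}

lemma levelCard_splitStates_le_ncard_splitBridges (h : IsTerminalGraph n (m + 1) G s t) :
    levelCard (G.splitStates s t) m ≤ (splitBridges G s t).ncard := by
  have hfin : (splitBridges G s t).Finite := (finite_edgeSet h).subset fun e he ↦ he.1
  refine (Set.ncard_le_ncard ?_ (hfin.image fun e ↦ E(G) \ {e})).trans (Set.ncard_image_le hfin)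
  rintro F ⟨hF, rfl⟩
  have hcompl : (E(G) \ F).ncard = 1 := by
    rw [Set.ncard_sdiff hF.1 ((finite_edgeSet h).subset hF.1), ncard_edgeSet h,
      Nat.add_sub_cancel_left]
  obtain ⟨e, he⟩ := Set.ncard_eq_one.1 hcompl
  have heF : E(G) \ {e} = F := by rw [← he, Set.sdiff_sdiff_cancel_left hF.1]
  have heE : e ∈ E(G) := (he ▸ Set.mem_singleton e : e ∈ E(G) \ F).1
  exact ⟨e, ⟨heE, heF ▸ hF⟩, heF⟩

lemma splitBridges_subset (hs : s ∈ V(G)) (hF : F ⊆ E(G))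
    (hst : (G.restrict F).Communicates s t) : splitBridges G s t ⊆ F := by
  intro e he
  by_contra heF
  exact not_communicates_of_mem_splitStates hs he.2
    (communicates_restrict_mono (fun f hf ↦ ⟨hF hf, fun hfe ↦ heF (hfe ▸ hf)⟩) hst)

lemma exists_splitBridges_subset_insert (h : IsTerminalGraph n m G s t)
    (hF : F ∈ G.splitStates s t) : ∃ e, splitBridges G s t ⊆ insert e F := by
  obtain ⟨e, u, v, hl, hsu, hsv⟩ := exists_isLink_mem_notMem h.connected
    (S := {v | (G.restrict F).Communicates s v}) h.left_mem h.right_mem .refl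
    (not_communicates_of_mem_splitStates h.left_mem hF)
  have hvt : (G.restrict F).Communicates v t :=
    (hF.2 v hl.right_mem).or.resolve_left fun hvs ↦ hsv (communicates_symm hvs)
  exact ⟨e, splitBridges_subset h.left_mem (Set.insert_subset hl.edge_mem hF.1)
    ((communicates_restrict_insert_iff hl).2 (.inr (.inl ⟨hsu, hvt⟩)))⟩

lemma levelCard_splitStates_le_of_le_splitBridges (h : IsTerminalGraph n (m + k) G s t)
    (hm : m ≤ (splitBridges G s t).ncard) : levelCard (G.splitStates s t) m ≤ m * k + 1 := by
  obtain ⟨B, hB, rfl⟩ := Set.exists_subset_card_eq hm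
  have hBE : B ⊆ E(G) := hB.trans fun e he ↦ he.1
  have hk : (E(G) \ B).ncard = k := by
    rw [Set.ncard_sdiff hBE ((finite_edgeSet h).subset hBE), ncard_edgeSet h,
      Nat.add_sub_cancel_left]
  rw [← hk]
  exact levelCard_le_of_subset_insert (finite_edgeSet h) hBE (fun F hF ↦ hF.1) fun F hF ↦
    (exists_splitBridges_subset_insert h hF).imp fun _ ↦ hB.trans

lemma exists_tree_of_isLink (hG : G.IsConnected) (hl : G.IsLink f u v) (huv : u ≠ v)
    (hk : k + 2 ≤ V(G).encard) : ∃ F ⊆ E(G), f ∈ F ∧ F.encard ≤ k + 1 ∧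
      ∃ R ⊆ V(G), u ∈ R ∧ R.encard = k + 2 ∧ ∀ w ∈ R, (G.restrict F).Communicates w u := by
  induction k with
  | zero =>
    refine ⟨{f}, Set.singleton_subset_iff.2 hl.edge_mem, rfl, by simp, {u, v},
      Set.insert_subset hl.left_mem (Set.singleton_subset_iff.2 hl.right_mem), .inl rfl,
      by simp [Set.encard_pair huv], ?_⟩
    rintro w (rfl | rfl)
    · exact .refl
    · exact communicates_restrict_of_isLink rfl hl.symm
  | succ k ih =>
    have hlt : (k + 2 : ℕ∞) < V(G).encard := lt_of_lt_of_le (by norm_cast; omega) hk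
    obtain ⟨F, hFE, hfF, hFk, R, hRV, huR, hRk, hR⟩ := ih hlt.le
    obtain ⟨w, hw, hwR⟩ := Set.exists_of_ssubset (hRV.ssubset_of_ne fun h ↦ hlt.ne (h ▸ hRk).symm)
    obtain ⟨e, x, y, he, hx, hy⟩ := exists_isLink_mem_notMem hG hl.left_mem hw huR hwR
    refine ⟨insert e F, Set.insert_subset he.edge_mem hFE, .inr hfF, ?_, insert y R,
      Set.insert_subset he.right_mem hRV, .inr huR, ?_, ?_⟩
    · push_cast
      exact (Set.encard_insert_le F e).trans (by gcongr)
    · rw [Set.encard_insert_of_notMem hy, hRk]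
      push_cast
      ring
    · rintro z (rfl | hz)
      · exact (communicates_restrict_insert_iff he).2 (.inr (.inr ⟨.refl, hR x hx⟩))
      · exact communicates_restrict_mono (Set.subset_insert e F) (hR z hz)

lemma exists_superset_splitBridges (h : IsTerminalGraph (n + 2) m G s t) (hf : f ∈ E(G)) :
    ∃ F ⊆ E(G), f ∈ F ∧ splitBridges G s t ⊆ F ∧ F.ncard ≤ n + 1 := by
  have := h.loopless
  obtain ⟨u, v, hl⟩ := G.exists_isLink_of_mem_edgeSet hf
  obtain ⟨F, hF, hfF, hFn, R, hRV, -, hRn, hR⟩ :=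
    exists_tree_of_isLink h.connected hl hl.ne (k := n) h.order.ge
  have hRV : R = V(G) := (Set.finite_of_encard_eq_coe hRn).eq_of_subset_of_encard_le hRV
    (h.order.trans hRn.symm).le
  rw [← ((finite_edgeSet h).subset hF).cast_ncard_eq] at hFn
  exact ⟨F, hF, hfF, splitBridges_subset h.left_mem hF ((hR s (hRV ▸ h.left_mem)).trans
    (communicates_symm (hR t (hRV ▸ h.right_mem)))), by exact_mod_cast hFn⟩

lemma ncard_splitBridges_le (h : IsTerminalGraph (n + 2) m G s t) (hm : n + 1 < m) :
    (splitBridges G s t).ncard ≤ n := by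
  have hE := finite_edgeSet h
  obtain ⟨f, hf, hfB⟩ : ∃ f ∈ E(G), f ∉ splitBridges G s t := by
    by_contra! hEB
    obtain ⟨f, hf⟩ := Set.nonempty_of_ncard_ne_zero (s := E(G)) (by rw [ncard_edgeSet h]; omega)
    obtain ⟨F, hF, -, hBF, hFn⟩ := exists_superset_splitBridges h hf
    have hEF : E(G).ncard ≤ F.ncard := Set.ncard_le_ncard (hBF.trans' hEB) (hE.subset hF)
    rw [ncard_edgeSet h] at hEF
    omega
  obtain ⟨F, hF, hfF, hBF, hFn⟩ := exists_superset_splitBridges h hf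
  have hBF : (splitBridges G s t).ncard < F.ncard :=
    Set.ncard_lt_ncard ((Set.ssubset_iff_of_subset hBF).2 ⟨f, hfF, hfB⟩) (hE.subset hF)
  omega

end SplitBridges

section UpperBounds

variable {α β : Type*} {G : Graph α β} {F : Set β} {s t u v w : α} {n m d k : ℕ}

lemma encard_vertexSet_sdiff (h : IsTerminalGraph (n + 2) m G s t) :
    (V(G) \ {s, t}).encard = n := by
  have hst : {s, t} ⊆ V(G) := Set.insert_subset h.left_mem (Set.singleton_subset_iff.2 h.right_mem)
  have hcard := Set.encard_sdiff_add_encard_of_subset hst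
  rw [Set.encard_pair h.ne, h.order] at hcard
  exact ENat.add_left_injective_of_ne_top (n := 2) (ENat.ofNat_ne_top 2) hcard

lemma exists_isLink_of_mem_splitStates (hF : F ∈ G.splitStates s t) {S : Set α} (hv : v ∈ V(G))
    (hvS : v ∈ S) (hs : s ∉ S) (ht : t ∉ S) : ∃ e ∈ F, ∃ x ∈ S, ∃ y ∉ S, G.IsLink e x y := by
  by_contra! hclosed
  have hS : ∀ e x y, (G.restrict F).IsLink e x y → x ∈ S → y ∈ S := fun e x y hl hx ↦
    by_contra fun hy ↦ hclosed e hl.1 x hx y hy hl.2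
  rcases (hF.2 v hv).or with hvs | hvt
  · exact hs (mem_of_communicates hS hvs hvS)
  · exact ht (mem_of_communicates hS hvt hvS)

lemma ncard_setOf_isLink_lt (h : IsTerminalGraph n m G s t) (hu : u ∈ V(G)) (hw : w ∈ V(G))
    (hwu : w ≠ u) (hwv : w ≠ v) : {e | G.IsLink e u v}.ncard < m := by
  obtain ⟨e, x, y, hl, rfl, -⟩ := exists_isLink_mem_notMem h.connected (S := {w}) hw hu rfl hwu.symm
  rw [← ncard_edgeSet h]
  refine Set.ncard_lt_ncard ⟨fun f hf ↦ IsLink.edge_mem hf, fun hE ↦ ?_⟩ (finite_edgeSet h)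
  exact (hl.left_eq_or_eq (hE hl.edge_mem : G.IsLink e u v)).elim hwu hwv

lemma succ_choose_add_succ_choose_le (a b j : ℕ) :
    (a + 1).choose (j + 1) + (b + 1).choose (j + 1) ≤
      (a + b + 1).choose (j + 1) + if j = 0 then 1 else 0 := by
  induction b with
  | zero => cases j <;> simp [Nat.choose_eq_zero_of_lt]
  | succ b ih =>
    rw [Nat.choose_succ_succ' (b + 1), ← add_assoc a b 1, Nat.choose_succ_succ' (a + b + 1)]
    have hmono : (b + 1).choose j ≤ (a + b + 1).choose j := Nat.choose_le_choose j (by omega)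
    omega

lemma choose_add_choose_le {a b : ℕ} (ha : a ≤ k) (hb : b ≤ k) (hab : a + b ≤ k + 1) (j : ℕ) :
    a.choose (j + 1) + b.choose (j + 1) ≤ k.choose (j + 1) + if j = 0 then 1 else 0 := by
  rcases a with - | a
  · rw [Nat.choose_zero_succ, zero_add]
    exact le_add_right (Nat.choose_le_choose _ hb)
  rcases b with - | b
  · rw [Nat.choose_zero_succ, add_zero]
    exact le_add_right (Nat.choose_le_choose _ ha)
  refine (succ_choose_add_succ_choose_le a b j).trans ?_
  gcongr
  omega

lemma splitStates_subset_of_order_three (h : IsTerminalGraph 3 m G s t)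
    (hv : V(G) \ {s, t} = {v}) :
    G.splitStates s t ⊆ 𝒫 {e | G.IsLink e s v} ∪ 𝒫 {e | G.IsLink e t v} := by
  intro F hF
  have := h.loopless
  have hst := not_communicates_of_mem_splitStates h.left_mem hF
  have hV : ∀ x ∈ V(G), x = s ∨ x = t ∨ x = v := fun x hx ↦ by
    by_contra! hne
    exact hne.2.2 (hv.subset ⟨hx, not_or.2 ⟨hne.1, hne.2.1⟩⟩)
  have hlink : ∀ e ∈ F, G.IsLink e s v ∨ G.IsLink e t v := by
    intro e he
    obtain ⟨x, y, hl⟩ := exists_isLink_of_mem_edgeSet (hF.1 he)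
    have hne : ¬ G.IsLink e s t := fun hl ↦ hst (communicates_restrict_of_isLink he hl)
    have hxy := hl.ne
    rcases hV x hl.left_mem with rfl | rfl | rfl <;>
      rcases hV y hl.right_mem with rfl | rfl | rfl <;>
      first | exact absurd rfl hxy | simp_all [isLink_comm]
  rcases (hF.2 v (hv.symm.subset rfl).1).or with hvs | hvt
  · refine .inl fun e he ↦ (hlink e he).resolve_right fun hl ↦ hst ?_
    exact communicates_symm ((communicates_restrict_of_isLink he hl).trans hvs)
  · exact .inr fun e he ↦ (hlink e he).resolve_left fun hl ↦
      hst ((communicates_restrict_of_isLink he hl).trans hvt)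

lemma levelCard_splitStates_le_of_order_three (h : IsTerminalGraph 3 (1 + k) G s t) (j : ℕ) :
    levelCard (G.splitStates s t) (1 + j) ≤ chainCount 1 k j := by
  rw [add_comm 1 k] at h
  obtain ⟨v, hv⟩ := Set.encard_eq_one.1 (encard_vertexSet_sdiff (n := 1) h)
  obtain ⟨-, hvst⟩ : v ∈ V(G) \ {s, t} := hv ▸ rfl
  rw [Set.mem_insert_iff, Set.mem_singleton_iff, not_or] at hvst
  set A : Set β := {e | G.IsLink e s v}
  set B : Set β := {e | G.IsLink e t v}
  have hAE : A ⊆ E(G) := fun e he ↦ IsLink.edge_mem he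
  have hBE : B ⊆ E(G) := fun e he ↦ IsLink.edge_mem he
  have hA : A.Finite := (finite_edgeSet h).subset hAE
  have hB : B.Finite := (finite_edgeSet h).subset hBE
  have hdisj : Disjoint A B := Set.disjoint_left.2 fun e (heA : G.IsLink e s v) heB ↦
    h.ne (heA.left_unique heB)
  have hAB : A.ncard + B.ncard ≤ k + 1 := by
    rw [← Set.ncard_union_eq hdisj hA hB, ← ncard_edgeSet h]
    exact Set.ncard_le_ncard (Set.union_subset hAE hBE) (finite_edgeSet h)
  have hAk : A.ncard < k + 1 :=
    ncard_setOf_isLink_lt h h.left_mem h.right_mem h.ne.symm (Ne.symm hvst.2)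
  have hBk : B.ncard < k + 1 :=
    ncard_setOf_isLink_lt h h.right_mem h.left_mem h.ne (Ne.symm hvst.1)
  rw [add_comm 1 j, chainCount, one_mul]
  calc levelCard (G.splitStates s t) (j + 1) ≤ levelCard (𝒫 A ∪ 𝒫 B) (j + 1) :=
        levelCard_mono (hA.powerset.union hB.powerset) (splitStates_subset_of_order_three h hv) _
    _ ≤ levelCard (𝒫 A) (j + 1) + levelCard (𝒫 B) (j + 1) := levelCard_union_le _ _ _
    _ = A.ncard.choose (j + 1) + B.ncard.choose (j + 1) := by
        rw [levelCard_powerset hA, levelCard_powerset hB]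
    _ ≤ k.choose (j + 1) + if j = 0 then 1 else 0 :=
        choose_add_choose_le (Nat.le_of_lt_succ hAk) (Nat.le_of_lt_succ hBk) hAB j

lemma levelCard_splitStates_le_of_tree (h : IsTerminalGraph n (d + 1) G s t) (j : ℕ) :
    levelCard (G.splitStates s t) (d + j) ≤ chainCount d 1 j := by
  cases j with
  | zero => simpa [chainCount] using levelCard_splitStates_le_choose h d
  | succ j => exact (levelCard_splitStates_of_size_le h (by omega)).trans_le (Nat.zero_le _)

lemma subsingleton_setOf_not_inc
    (hE : ∀ e ∈ E(G), ∀ f ∈ E(G), e ≠ f → {e, f} ∈ G.splitStates s t)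
    (hv : v ∈ V(G) \ {s, t}) : {e ∈ E(G) | ¬ G.Inc e v}.Subsingleton := by
  refine fun e he f hf ↦ by_contra fun hef ↦ ?_
  obtain ⟨g, rfl | rfl, x, rfl, y, -, hl⟩ :=
    exists_isLink_of_mem_splitStates (hE e he.1 f hf.1 hef) hv.1 (S := {v}) rfl
      (fun hs ↦ hv.2 (.inl hs.symm)) (fun ht ↦ hv.2 (.inr ht.symm))
  · exact he.2 hl.inc_left
  · exact hf.2 hl.inc_left

lemma exists_pair_notMem_splitStates (h : IsTerminalGraph 4 4 G s t) :
    ∃ e ∈ E(G), ∃ f ∈ E(G), e ≠ f ∧ {e, f} ∉ G.splitStates s t := by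
  by_contra! hE
  obtain ⟨a, b, hab, hV⟩ := Set.encard_eq_two.1 (encard_vertexSet_sdiff (n := 2) h)
  have ha : a ∈ V(G) \ {s, t} := hV ▸ .inl rfl
  have hb : b ∈ V(G) \ {s, t} := hV ▸ .inr rfl
  have hcover : E(G) ⊆ {e | G.IsLink e a b} ∪
      ({e ∈ E(G) | ¬ G.Inc e a} ∪ {e ∈ E(G) | ¬ G.Inc e b}) := fun e he ↦ by
    by_cases hea : G.Inc e a
    · by_cases heb : G.Inc e b
      · obtain ⟨y, hl⟩ := hea
        exact .inl (heb.eq_of_isLink_of_ne_left hl hab.symm ▸ hl)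
      · exact .inr (.inr ⟨he, heb⟩)
    · exact .inr (.inl ⟨he, hea⟩)
  obtain ⟨e, he, f, hf, hef⟩ : {e | G.IsLink e a b}.Nontrivial := by
    by_contra hlink
    have hle : E(G).encard ≤ 1 + (1 + 1) := calc
      E(G).encard ≤ {e | G.IsLink e a b}.encard +
          ({e ∈ E(G) | ¬ G.Inc e a}.encard + {e ∈ E(G) | ¬ G.Inc e b}.encard) :=
        (Set.encard_le_encard hcover).trans ((Set.encard_union_le _ _).trans
          (by gcongr; exact Set.encard_union_le _ _))
      _ ≤ 1 + (1 + 1) := by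
        gcongr <;> rw [Set.encard_le_one_iff_subsingleton]
        · exact Set.not_nontrivial_iff.1 hlink
        · exact subsingleton_setOf_not_inc hE ha
        · exact subsingleton_setOf_not_inc hE hb
    rw [h.size] at hle
    exact absurd hle (by norm_num)
  obtain ⟨g, hg, x, -, y, hy, hl⟩ := exists_isLink_of_mem_splitStates (S := {a, b})
    (hE e (IsLink.edge_mem he) f (IsLink.edge_mem hf) hef) ha.1 (.inl rfl)
    (hV ▸ fun hs ↦ hs.2 (.inl rfl)) (hV ▸ fun ht ↦ ht.2 (.inr rfl))
  have hgab : G.IsLink g a b := by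
    rcases hg with rfl | rfl
    · exact he
    · exact hf
  exact hy (hl.symm.left_eq_or_eq hgab)

lemma levelCard_splitStates_le_of_order_four (h : IsTerminalGraph 4 4 G s t) (j : ℕ) :
    levelCard (G.splitStates s t) (2 + j) ≤ chainCount 2 2 j := by
  rcases j with - | - | j
  · obtain ⟨e, he, f, hf, hef, hpair⟩ := exists_pair_notMem_splitStates h
    have hlt := levelCard_lt_choose (finite_edgeSet h) (fun F hF ↦ hF.1) (Set.pair_subset he hf)
      hpair
    rw [Set.ncard_pair hef, ncard_edgeSet h] at hlt
    exact Nat.le_of_lt_succ hlt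
  · exact (levelCard_splitStates_le_ncard_splitBridges h).trans
      (ncard_splitBridges_le (n := 2) h (by norm_num))
  · exact (levelCard_splitStates_of_size_le h (by omega)).trans_le (Nat.zero_le _)

end UpperBounds

section Optimality

variable {α β : Type} {G : Graph α β} {s t : α} {d k c l : ℕ}

lemma exists_isOptimal (hk : 1 ≤ k)
    (h : ∀ (α β : Type) (H : Graph α β) (s t : α), IsTerminalGraph (d + 2) (d + k) H s t →
      ∀ j, levelCard (H.splitStates s t) (d + j) ≤ chainCount d k j) :
    ∃ (α β : Type) (G : Graph α β) (s t : α), IsOptimal (d + 2) (d + k) G s t := by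
  obtain ⟨G, s, t, hG, hcount⟩ := exists_chain d hk
  refine ⟨ℕ, ℕ, G, s, t, hG, fun α β H s' t' hH p hp ↦ splitReliability_le hG hH (fun i ↦ ?_) hp⟩
  obtain hi | ⟨j, rfl⟩ := (lt_or_ge i d).imp_right Nat.exists_eq_add_of_le
  · exact (levelCard_splitStates_of_lt hH (by omega)).trans_le (Nat.zero_le _)
  · exact (h α β H s' t' hH j).trans_eq (hcount j).symm

lemma le_ncard_splitBridges_of_isOptimal (hG : IsOptimal (d + 2) (d + k + 1) G s t) :
    d ≤ (splitBridges G s t).ncard := by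
  obtain ⟨H, s', t', hH, hcount⟩ := exists_chain d (Nat.le_add_left 1 k)
  calc d ≤ chainCount d (k + 1) k := by
        rw [chainCount, Nat.choose_self, mul_one]
        exact Nat.le_add_right d _
    _ = levelCard (H.splitStates s' t') (d + k) := (hcount k).symm
    _ ≤ levelCard (G.splitStates s t) (d + k) := levelCard_highest_le hG.1 hH (hG.2 _ _ _ _ _ hH)
    _ ≤ (splitBridges G s t).ncard := levelCard_splitStates_le_ncard_splitBridges hG.1

lemma not_isOptimal (hcl : 1 < c * l) : ¬ IsOptimal (c + 3) (c + l + 2) G s t := by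
  intro hG
  have hsize : c + l + 2 = c + 1 + l + 1 := by ring
  have hl : 1 ≤ l := Nat.pos_of_mul_pos_left (zero_lt_one.trans hcl)
  obtain ⟨H, s', t', hH, hcount⟩ := exists_triangleChain c hl
  have hbridges : c + 1 ≤ (splitBridges G s t).ncard :=
    le_ncard_splitBridges_of_isOptimal (k := l) (hsize ▸ hG)
  have hupper : levelCard (G.splitStates s t) (c + 1) ≤ (c + 1) * (l + 1) + 1 :=
    levelCard_splitStates_le_of_le_splitBridges (hsize ▸ hG.1) hbridges
  have hlower : c * (2 * l + 1) + (l + 1) ≤ levelCard (G.splitStates s t) (c + 1) :=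
    hcount ▸ levelCard_lowest_le (r := l + 1) (hsize ▸ hG.1) (hsize ▸ hH) (hG.2 _ _ _ _ _ hH)
  linarith

end Optimality

end SplitReliability

theorem mainTheorem1 (n m : ℕ) (hn : 2 ≤ n) (hm : n - 1 ≤ m) :
    (∃ (α β : Type) (G : Graph α β) (s t : α), Graph.IsOptimal n m G s t) ↔
      n ≤ 3 ∨ m = n - 1 ∨ (n = 4 ∧ m = 4) := by
  obtain ⟨d, rfl⟩ : ∃ d, n = d + 2 := Nat.exists_eq_add_of_le' hn
  obtain ⟨k, rfl⟩ : ∃ k, m = d + k := Nat.exists_eq_add_of_le (by omega)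
  constructor
  · rintro ⟨α, β, G, s, t, hG⟩
    by_contra! hne
    obtain ⟨c, rfl⟩ : ∃ c, d = c + 1 := Nat.exists_eq_add_of_le' (by omega)
    obtain ⟨l, rfl⟩ : ∃ l, k = l + 1 := Nat.exists_eq_add_of_le' (by omega)
    have hcl : 1 < c * l := Nat.one_lt_mul_iff.2 (by omega)
    rw [show c + 1 + (l + 1) = c + l + 2 by ring] at hG
    exact SplitReliability.not_isOptimal hcl hG
  · intro h
    refine SplitReliability.exists_isOptimal (by omega) fun α β H s t hH j ↦ ?_
    obtain rfl | rfl | rfl | ⟨rfl, rfl⟩ : d = 0 ∨ d = 1 ∨ k = 1 ∨ (d = 2 ∧ k = 2) := by omega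
    · rw [zero_add, SplitReliability.levelCard_splitStates_order_two hH]
      exact Nat.le_add_left _ _
    · exact SplitReliability.levelCard_splitStates_le_of_order_three hH j
    · exact SplitReliability.levelCard_splitStates_le_of_tree hH j
    · exact SplitReliability.levelCard_splitStates_le_of_order_four hH j
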